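/- Let $n$ be a natural number and let $V$ be a complex vector space of dimension $2n+2$. Let $\mathbb P^{2n+1}=\mathbb P(V)$ be the projective space of lines of $V$, and let $Q$ be its quotient bundle, defined by the exact sequence $$0\to\mathcal O(-1)\xrightarrow{\ g\ }V\otimes\mathcal O\to Q\to 0 ,$$ where $g$ is the tautological inclusion. Let $f\in\bigwedge^2V^*$ be a nondegenerate alternating bilinear form on $V$, and let $H\subset\bigwedge^2V$ be the kernel of the linear form $u\wedge v\mapsto f(u,v)$. The null-correlation bundle $N(f)$ is the kernel of the surjection $Q\to\mathcal O(1)$ induced by ${}^Tg\circ f:V\otimes\mathcal O\to\mathcal O(1)$. Let $W\subset\bigwedge^2V$ be a linear subspace with $\dim W=\binom{2n+2}{2}-4n-1$ which contains no nonzero decomposable vector $u\wedge v$ (the Tango condition). Let $\varpi_W:Q(-1)\to(\bigwedge^2V/W)\otimes\mathcal O$ be the morphism which on the fibre at the line $\mathbb C v$ is $[u]\otimes v\mapsto v\wedge u \bmod W$. The Tango bundle $F(W)$ is defined by the exact sequence $$0\to Q(-1)\xrightarrow{\varpi_W}\Big(\bigwedge^2V/W\Big)\otimes\mathcal O\xrightarrow{\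 p\ }F(W)(1)\to0 .$$ If $W\subset H$, then there is an exact sequence of sheaves of $\mathcal O$-modules on $\mathbb P^{2n+1}$ $$0\to N(f)(-1)\to (H/W)\otimes\mathcal O\to F(W)(1)\to0 ,$$ in which the second morphism is the restriction of $p$ to $(H/W)\otimes\mathcal O\subset(\bigwedge^2V/W)\otimes\mathcal O$, and the first one, followed by this inclusion, is the composite of $N(f)(-1)\subset Q(-1)$ with $\varpi_W$. -/

import Mathlib

open CategoryTheory CategoryTheory.Limits TopologicalSpace
open scoped LinearAlgebra.Projectivization

universe u w

namespace ProjBundle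


section Sections

variable {V : Type u} [AddCommGroup V] [Module ℂ V]

variable (V) in
/-- The algebra of polynomial functions on `V`: it is generated by the linear forms. -/
def polyFun : Subalgebra ℂ (V → ℂ) :=
  Algebra.adjoin ℂ (Set.range fun l : Module.Dual ℂ V => (l : V → ℂ))

variable (V) in
/-- The polynomial functions on `V` with values in a vector space `E`: finite sums of functions
`v ↦ p v • e`, with `p` a polynomial function and `e ∈ E`. -/
def vecPoly (E : Type w) [AddCommGroup E] [Module ℂ E] : Submodule ℂ (V → E) :=
  Submodule.span ℂ {P | ∃ p ∈ polyFun V, ∃ e : E, P = fun v => p v • e}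

/-- `P` is homogeneous of degree `d`. -/
def IsHomog {E : Type w} [AddCommGroup E] [Module ℂ E] (d : ℤ) (P : V → E) : Prop :=
  ∀ (c : ℂ) (v : V), c ≠ 0 → P (c • v) = c ^ d • P v

/-- The set of points of `ℙ(V)` (lines of `V`) at which a homogeneous polynomial function
does not vanish. -/
def nonvanishing (q : V → ℂ) : Set (ℙ ℂ V) :=
  {x | ∀ v ∈ x.submodule, v ≠ 0 → q v ≠ 0}

variable (V) in
/-- The Zariski topology of `ℙ(V)`. -/
@[reducible] def zariski : TopologicalSpace (ℙ ℂ V) :=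
  TopologicalSpace.generateFrom
    {D | ∃ q ∈ polyFun V, ∃ d : ℤ, IsHomog d q ∧ D = nonvanishing q}

variable (V) in
/-- The projective space of the lines of `V`, with its Zariski topology. -/
def PSpace : TopCat.{u} := @TopCat.of (ℙ ℂ V) (zariski V)

/-- The nonzero vectors of the line `x`. -/
def Punctured (x : PSpace V) : Type u :=
  {v : V // v ∈ Projectivization.submodule (K := ℂ) (V := V) x ∧ v ≠ 0}

variable (V) in
/-- The functions on the cone over an open set of `ℙ(V)` with values in `E` which are of the form
`v ↦ P v / q v`, with `P` and `q` homogeneous polynomial functions, `deg P - deg q = k`. -/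
def isFraction (E : Type w) [AddCommGroup E] [Module ℂ E] (k : ℤ) :
    TopCat.PrelocalPredicate fun x : PSpace V => (Punctured x → E) where
  pred {U} s := ∃ d : ℤ, ∃ P ∈ vecPoly V E, ∃ q ∈ polyFun V, IsHomog (d + k) P ∧ IsHomog d q ∧
    ∀ (x : U) (v : Punctured x.1), q v.1 ≠ 0 ∧ s x v = (q v.1)⁻¹ • P v.1
  res := by
    rintro U U' i s ⟨d, P, hP, q, hq, hPh, hqh, h⟩
    exact ⟨d, P, hP, q, hq, hPh, hqh, fun x v => h (i x) v⟩

variable (V) in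
/-- The functions which are locally fractions of degree `k`. -/
def isRegular (E : Type w) [AddCommGroup E] [Module ℂ E] (k : ℤ) :
    TopCat.LocalPredicate fun x : PSpace V => (Punctured x → E) :=
  (isFraction V E k).sheafify

section lemmas

variable {E : Type w} [AddCommGroup E] [Module ℂ E]

lemma smul_vecPoly {p : V → ℂ} (hp : p ∈ polyFun V) {P : V → E} (hP : P ∈ vecPoly V E) :
    (fun v => p v • P v) ∈ vecPoly V E := by
  induction hP using Submodule.span_induction with
  | mem P h =>
    obtain ⟨r, hr, e, rfl⟩ := h
    refine Submodule.subset_span ⟨p * r, mul_mem hp hr, e, ?_⟩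
    funext v
    simp [mul_smul]
  | zero =>
    have : (fun v => p v • (0 : V → E) v) = 0 := by funext v; simp
    rw [this]; exact zero_mem _
  | add P Q _ _ h1 h2 =>
    have : (fun v => p v • (P + Q) v) = (fun v => p v • P v) + fun v => p v • Q v := by
      funext v; simp
    rw [this]; exact add_mem h1 h2
  | smul c P _ h =>
    have : (fun v => p v • (c • P) v) = c • fun v => p v • P v := by
      funext v; exact smul_comm _ _ _
    rw [this]; exact Submodule.smul_mem _ _ h

lemma vecPoly_le {P : V → ℂ} (hP : P ∈ vecPoly V ℂ) : P ∈ polyFun V := by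
  induction hP using Submodule.span_induction with
  | mem P h =>
    obtain ⟨r, hr, e, rfl⟩ := h
    have : (fun v => r v • e) = e • r := by funext v; simp [mul_comm]
    rw [this]; exact Subalgebra.smul_mem _ hr e
  | zero => exact zero_mem _
  | add P Q _ _ h1 h2 => exact add_mem h1 h2
  | smul c P _ h => exact Subalgebra.smul_mem _ h c

lemma le_vecPoly {P : V → ℂ} (hP : P ∈ polyFun V) : P ∈ vecPoly V ℂ :=
  Submodule.subset_span ⟨P, hP, 1, by simp⟩

lemma comp_vecPoly {E' : Type*} [AddCommGroup E'] [Module ℂ E'] (L : E →ₗ[ℂ] E')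
    {P : V → E} (hP : P ∈ vecPoly V E) : (fun v => L (P v)) ∈ vecPoly V E' := by
  induction hP using Submodule.span_induction with
  | mem P h =>
    obtain ⟨r, hr, e, rfl⟩ := h
    exact Submodule.subset_span ⟨r, hr, L e, by simp⟩
  | zero =>
    have : (fun v => L ((0 : V → E) v)) = 0 := by funext v; simp
    rw [this]; exact zero_mem _
  | add P Q _ _ h1 h2 =>
    have : (fun v => L ((P + Q) v)) = (fun v => L (P v)) + fun v => L (Q v) := by
      funext v; simp
    rw [this]; exact add_mem h1 h2
  | smul c P _ h =>
    have : (fun v => L ((c • P) v)) = c • fun v => L (P v) := by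
      funext v; simp
    rw [this]; exact Submodule.smul_mem _ _ h

lemma linear_vecPoly [FiniteDimensional ℂ V] (L : V →ₗ[ℂ] E) : (fun v => L v) ∈ vecPoly V E := by
  let b := Module.finBasis ℂ V
  have : (fun v => L v) = ∑ i, fun v => b.coord i v • L (b i) := by
    funext v
    conv_lhs => rw [← b.sum_repr v]
    simp only [Finset.sum_apply, Module.Basis.coord_apply, map_sum, map_smul]
  rw [this]
  exact Submodule.sum_mem _ fun i _ =>
    Submodule.subset_span ⟨b.coord i, Algebra.subset_adjoin ⟨_, rfl⟩, _, rfl⟩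

lemma bilin_vecPoly [FiniteDimensional ℂ V] {E' : Type*} [AddCommGroup E'] [Module ℂ E']
    (B : V →ₗ[ℂ] E →ₗ[ℂ] E') {P : V → E} (hP : P ∈ vecPoly V E) :
    (fun v => B v (P v)) ∈ vecPoly V E' := by
  induction hP using Submodule.span_induction with
  | mem P h =>
    obtain ⟨r, hr, e, rfl⟩ := h
    have := smul_vecPoly hr (linear_vecPoly (B.flip e))
    simpa using this
  | zero =>
    have : (fun v => B v ((0 : V → E) v)) = 0 := by funext v; simp
    rw [this]; exact zero_mem _
  | add P Q _ _ h1 h2 =>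
    have : (fun v => B v ((P + Q) v)) = (fun v => B v (P v)) + fun v => B v (Q v) := by
      funext v; simp
    rw [this]; exact add_mem h1 h2
  | smul c P _ h =>
    have : (fun v => B v ((c • P) v)) = c • fun v => B v (P v) := by
      funext v; simp
    rw [this]; exact Submodule.smul_mem _ _ h

lemma isHomog_mul {E : Type*} [AddCommGroup E] [Module ℂ E] {d e : ℤ} {q : V → ℂ} {P : V → E}
    (hq : IsHomog d q) (hP : IsHomog e P) : IsHomog (d + e) fun v => q v • P v := by
  intro c v hc
  simp only [hq c v hc, hP c v hc, zpow_add₀ hc, smul_smul, smul_eq_mul]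
  congr 1; ring

variable {k : ℤ}

lemma isRegular_zero (U : Opens (PSpace V)) :
    (isRegular V E k).pred (fun (_ : U) _ => (0 : E)) := fun x =>
  ⟨U, x.2, 𝟙 U, 0, 0, zero_mem _, 1, one_mem _, by intro c v _; simp, by intro c v _; simp,
    fun _ _ => by simp⟩

lemma isRegular_one (U : Opens (PSpace V)) :
    (isRegular V ℂ 0).pred (fun (_ : U) _ => (1 : ℂ)) := fun x =>
  ⟨U, x.2, 𝟙 U, 0, 1, le_vecPoly (one_mem _), 1, one_mem _, by intro c v _; simp,
    by intro c v _; simp, fun _ _ => by simp⟩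

lemma isRegular_add {U : Opens (PSpace V)} {s t : ∀ x : U, Punctured x.1 → E}
    (hs : (isRegular V E k).pred s) (ht : (isRegular V E k).pred t) :
    (isRegular V E k).pred (fun x v => s x v + t x v) := by
  refine TopCat.PrelocalPredicate.sheafify_inductionOn₂' _ _ (isFraction V E k)
    (fun a b v => a v + b v) ?_ hs ht
  rintro U U' a b ⟨d, P, hP, q, hq, hPh, hqh, h⟩ ⟨d', P', hP', q', hq', hPh', hqh', h'⟩
  refine ⟨d + d', fun v => q' v • P v + q v • P' v,
    add_mem (smul_vecPoly hq' hP) (smul_vecPoly hq hP'), q * q', mul_mem hq hq', ?_,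
    isHomog_mul hqh hqh', fun x v => ?_⟩
  · intro c v hc
    have h1 := isHomog_mul hqh' hPh c v hc
    have h2 := isHomog_mul hqh hPh' c v hc
    beta_reduce at h1 h2 ⊢
    rw [h1, h2, smul_add]
    congr 3 <;> ring
  · obtain ⟨h1, h2⟩ := h ⟨x.1, x.2.1⟩ v
    obtain ⟨h3, h4⟩ := h' ⟨x.1, x.2.2⟩ v
    refine ⟨mul_ne_zero h1 h3, ?_⟩
    beta_reduce
    erw [h2, h4]
    rw [Pi.mul_apply, smul_add, smul_smul, smul_smul]
    congr 2 <;> field_simp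

lemma isRegular_smul {j n : ℤ} (hn : n = k + j) {U : Opens (PSpace V)}
    {a : ∀ x : U, Punctured x.1 → ℂ} {s : ∀ x : U, Punctured x.1 → E}
    (ha : (isRegular V ℂ j).pred a) (hs : (isRegular V E k).pred s) :
    (isRegular V E n).pred (fun x v => a x v • s x v) := by
  refine TopCat.PrelocalPredicate.sheafify_inductionOn₂' _ _ (isFraction V E n)
    (fun a b v => a v • b v) ?_ ha hs
  rintro U U' a b ⟨d, P, hP, q, hq, hPh, hqh, h⟩ ⟨d', P', hP', q', hq', hPh', hqh', h'⟩
  refine ⟨d + d', fun v => P v • P' v, smul_vecPoly (vecPoly_le hP) hP', q * q', mul_mem hq hq',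
    ?_, isHomog_mul hqh hqh', fun x v => ?_⟩
  · have := isHomog_mul hPh hPh'
    rwa [show d + j + (d' + k) = d + d' + n by rw [hn]; ring] at this
  · obtain ⟨h1, h2⟩ := h ⟨x.1, x.2.1⟩ v
    obtain ⟨h3, h4⟩ := h' ⟨x.1, x.2.2⟩ v
    refine ⟨mul_ne_zero h1 h3, ?_⟩
    beta_reduce
    erw [h2, h4]
    rw [Pi.mul_apply, smul_smul, smul_smul, smul_eq_mul]
    congr 1; rw [mul_inv]; ring

lemma isRegular_comp {E' : Type*} [AddCommGroup E'] [Module ℂ E'] (L : E →ₗ[ℂ] E')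
    {U : Opens (PSpace V)} {s : ∀ x : U, Punctured x.1 → E} (hs : (isRegular V E k).pred s) :
    (isRegular V E' k).pred (fun x v => L (s x v)) := by
  intro x
  obtain ⟨U', hx, i, d, P, hP, q, hq, hPh, hqh, h⟩ := hs x
  refine ⟨U', hx, i, d, _, comp_vecPoly L hP, q, hq, fun c v hc => ?_, hqh, fun x v => ?_⟩
  · simp [hPh c v hc]
  · exact ⟨(h x v).1, by simp [(h x v).2]⟩

lemma isRegular_bilin [FiniteDimensional ℂ V] {E' : Type*} [AddCommGroup E'] [Module ℂ E']
    (B : V →ₗ[ℂ] E →ₗ[ℂ] E') {n : ℤ} (hn : n = k + 1)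
    {U : Opens (PSpace V)} {s : ∀ x : U, Punctured x.1 → E} (hs : (isRegular V E k).pred s) :
    (isRegular V E' n).pred (fun x v => B v.1 (s x v)) := by
  intro x
  obtain ⟨U', hx, i, d, P, hP, q, hq, hPh, hqh, h⟩ := hs x
  refine ⟨U', hx, i, d, _, bilin_vecPoly B hP, q, hq, fun c v hc => ?_, hqh, fun x v => ?_⟩
  · have : d + n = (d + k) + 1 := by rw [hn]; ring
    simp [hPh c v hc, this, zpow_add₀ hc, smul_smul, mul_comm]
  · exact ⟨(h x v).1, by simp [(h x v).2]⟩

end lemmas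

variable (V) in
/-- The sections of `E ⊗ 𝒪(k)` over `U`: the functions `s` on the cone over `U`, with values in `E`,
which are regular and homogeneous of degree `k`. -/
def regSections (E : Type w) [AddCommGroup E] [Module ℂ E] (k : ℤ) (U : Opens (PSpace V)) :
    AddSubgroup (∀ x : U, Punctured x.1 → E) where
  carrier := {s | (isRegular V E k).pred s}
  zero_mem' := isRegular_zero U
  add_mem' := isRegular_add
  neg_mem' hs := by
    exact isRegular_comp (-LinearMap.id) hs

variable (V) in
/-- The ring of regular functions on `U`. -/
def regRing (U : Opens (PSpace V)) : Subring (∀ x : U, Punctured x.1 → ℂ) where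
  __ := regSections V ℂ 0 U
  one_mem' := isRegular_one U
  mul_mem' ha hb := isRegular_smul (zero_add 0).symm ha hb

instance {E : Type w} [AddCommGroup E] [Module ℂ E] {k : ℤ} {U : Opens (PSpace V)} :
    Module (regRing V U) (regSections V E k U) where
  smul a s := ⟨fun x v => a.1 x v • s.1 x v, isRegular_smul (add_zero k).symm a.2 s.2⟩
  one_smul s := by ext; exact one_smul _ _
  mul_smul a b s := by ext; exact mul_smul _ _ _
  smul_zero a := by ext; exact smul_zero _
  smul_add a s t := by ext; exact smul_add _ _ _
  add_smul a b s := by ext; exact add_smul _ _ _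
  zero_smul s := by ext; exact zero_smul _ _

variable (V) in
/-- The presheaf of rings of regular functions on `ℙ(V)`. -/
def structurePresheaf : (Opens (PSpace V))ᵒᵖ ⥤ CommRingCat.{u} where
  obj U := CommRingCat.of (regRing V U.unop)
  map i := CommRingCat.ofHom
    { toFun := fun s => ⟨fun x => s.1 (i.unop x), (isRegular V ℂ 0).res i.unop _ s.2⟩
      map_zero' := rfl
      map_add' := fun _ _ => rfl
      map_one' := rfl
      map_mul' := fun _ _ => rfl }

variable (V) in
/-- The structure sheaf of `ℙ(V)`. -/
abbrev structureSheaf : Sheaf (Opens.grothendieckTopology (PSpace V)) RingCat.{u} where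
  obj := structurePresheaf V ⋙ forget₂ CommRingCat RingCat
  property := (TopCat.Presheaf.isSheaf_iff_isSheaf_comp (forget RingCat) _).2
    (TopCat.subsheafToTypes (isRegular V ℂ 0)).property

variable (V) in
/-- The category of sheaves of modules on `ℙ(V)`. -/
abbrev Mod := SheafOfModules.{u} (structureSheaf V)

end Sections

section Twisted

variable (V : Type (max u w)) [AddCommGroup V] [Module ℂ V]
variable (E : Type w) [AddCommGroup E] [Module ℂ E]

/-- The presheaf of abelian groups of the sections of `E ⊗ 𝒪(k)`. -/
def secAb (k : ℤ) : (Opens (PSpace V))ᵒᵖ ⥤ Ab.{max u w} where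
  obj U := AddCommGrpCat.of (regSections V E k U.unop)
  map i := AddCommGrpCat.ofHom
    { toFun := fun s => ⟨fun x => s.1 (i.unop x), (isRegular V E k).res i.unop _ s.2⟩
      map_zero' := rfl
      map_add' := fun _ _ => rfl }

instance (k : ℤ) (U : (Opens (PSpace V))ᵒᵖ) :
    Module ((structureSheaf V).obj.obj U) ((secAb.{u, w} V E k).obj U) :=
  inferInstanceAs (Module (regRing V U.unop) (regSections V E k U.unop))

/-- The sheaf of modules `E ⊗ 𝒪(k)` on `ℙ(V)`. In particular `sec V E 0` is `E ⊗ 𝒪`,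
`sec V ℂ k` is `𝒪(k)`, and a section of `𝒪(-1)` is given by `a` such that `v ↦ a v • v`
is constant on each line. -/
noncomputable def sec (k : ℤ) : Mod V where
  val := PresheafOfModules.ofPresheaf (secAb.{u, w} V E k) (fun _ _ _ _ _ => rfl)
  isSheaf := (TopCat.Presheaf.isSheaf_iff_isSheaf_comp (forget Ab) _).2
    (TopCat.subsheafToTypes (isRegular V E k)).property

end Twisted

section Maps

universe w' w''

variable {V : Type (max u w w')} [AddCommGroup V] [Module ℂ V]
variable {E : Type w} [AddCommGroup E] [Module ℂ E] {E' : Type w'} [AddCommGroup E'] [Module ℂ E']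

/-- A morphism `E ⊗ 𝒪(k) ⟶ E' ⊗ 𝒪(n)` from compatible linear maps on the sections. -/
noncomputable def secHom {k n : ℤ}
    (φ : ∀ U : Opens (PSpace V), regSections V E k U →ₗ[regRing V U] regSections V E' n U)
    (hφ : ∀ (U U' : Opens (PSpace V)) (i : U' ⟶ U) (s : regSections V E k U) (x : U'),
      (φ U' ⟨fun y => s.1 (i y), (isRegular V E k).res i _ s.2⟩).1 x = (φ U s).1 (i x)) :
    sec.{max u w', w} V E k ⟶ sec.{max u w, w'} V E' n where
  val := PresheafOfModules.homMk
    { app := fun U => AddCommGrpCat.ofHom (φ U.unop).toAddMonoidHom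
      naturality := fun U U' i => by
        ext s
        exact Subtype.ext (funext fun x => hφ U.unop U'.unop i.unop s x) }
    (fun U r s => (φ U.unop).map_smul r s)

/-- The morphism `E ⊗ 𝒪(k) ⟶ E' ⊗ 𝒪(k)` given by a linear map `E → E'`. -/
noncomputable def mapSec (L : E →ₗ[ℂ] E') (k : ℤ) :
    sec.{max u w', w} V E k ⟶ sec.{max u w, w'} V E' k :=
  secHom.{u, w, w'}
    (fun U =>
      { toFun := fun s => ⟨fun x v => L (s.1 x v), isRegular_comp L s.2⟩
        map_add' := fun s t => by ext; exact map_add L _ _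
        map_smul' := fun r s => by ext; exact map_smul L _ _ })
    (fun _ _ _ _ _ => rfl)

/-- The morphism `E ⊗ 𝒪(k) ⟶ E' ⊗ 𝒪(k + 1)`, `s ↦ (v ↦ B v (s v))`, given by a bilinear map
`B : V × E → E'`. -/
noncomputable def bilinSec [FiniteDimensional ℂ V] (B : V →ₗ[ℂ] E →ₗ[ℂ] E') (k n : ℤ)
    (hn : n = k + 1) : sec.{max u w', w} V E k ⟶ sec.{max u w, w'} V E' n :=
  secHom.{u, w, w'}
    (fun U =>
      { toFun := fun s => ⟨fun x v => B v.1 (s.1 x v), isRegular_bilin B hn s.2⟩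
        map_add' := fun s t => by ext x v; exact map_add (B v.1) _ _
        map_smul' := fun r s => by ext x v; exact map_smul (B v.1) _ _ })
    (fun _ _ _ _ _ => rfl)

lemma bilinSec_comp_eq_zero {V : Type (max u w w' w'')} [AddCommGroup V] [Module ℂ V]
    [FiniteDimensional ℂ V] {E'' : Type w''}
    [AddCommGroup E''] [Module ℂ E''] (B : V →ₗ[ℂ] E →ₗ[ℂ] E') (B' : V →ₗ[ℂ] E' →ₗ[ℂ] E'')
    (h : ∀ v e, B' v (B v e) = 0) (k m n : ℤ) (hm : m = k + 1) (hn : n = m + 1) :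
    bilinSec.{max u w'', w, w'} B k m hm ≫ bilinSec.{max u w, w', w''} B' m n hn = 0 := by
  apply SheafOfModules.hom_ext
  apply PresheafOfModules.hom_ext
  intro U
  apply ModuleCat.hom_ext
  apply LinearMap.ext
  intro s
  exact Subtype.ext (funext fun x => funext fun v => h v.1 _)

end Maps

section Twist

variable {V : Type u} [AddCommGroup V] [Module ℂ V]

/-- The twist `M ↦ M(k) = M ⊗ 𝒪(k)`: the sheaf associated with the presheaf
`U ↦ M(U) ⊗ 𝒪(k)(U)` (tensor product over the ring of regular functions on `U`). -/
noncomputable def twist (k : ℤ) : Mod V ⥤ Mod V :=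
  SheafOfModules.forget (structureSheaf V) ⋙
    MonoidalCategory.tensorRight
      (C := PresheafOfModules.{u} (structurePresheaf V ⋙ forget₂ CommRingCat RingCat))
      (sec.{u, 0} V ℂ k).val ⋙
    PresheafOfModules.sheafification (𝟙 (structureSheaf V).obj)

end Twist

section Mul

variable {V : Type (max u w)} [AddCommGroup V] [Module ℂ V]
variable (E : Type w) [AddCommGroup E] [Module ℂ E]

/-- The product of sections, as a morphism of presheaves. -/
noncomputable def mulPre (k m n : ℤ) (hn : n = k + m) :
    (MonoidalCategory.tensorObj
      (C := PresheafOfModules.{max u w} (structurePresheaf V ⋙ forget₂ CommRingCat RingCat))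
      (sec.{u, w} V E k).val (sec.{max u w, 0} V ℂ m).val) ⟶ (sec.{u, w} V E n).val where
  app U := ModuleCat.MonoidalCategory.tensorLift (R := (structurePresheaf V).obj U)
    (fun (s : regSections V E k U.unop) (a : regSections V ℂ m U.unop) =>
      (⟨fun x v => a.1 x v • s.1 x v, isRegular_smul hn a.2 s.2⟩ : regSections V E n U.unop))
    (fun _ _ _ => Subtype.ext (funext fun _ => funext fun _ => smul_add _ _ _))
    (fun _ _ _ => Subtype.ext (funext fun _ => funext fun _ => smul_comm _ _ _))
    (fun _ _ _ => Subtype.ext (funext fun _ => funext fun _ => add_smul _ _ _))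
    (fun _ _ _ => Subtype.ext (funext fun _ => funext fun _ => mul_smul _ _ _))
  naturality _ := ModuleCat.MonoidalCategory.tensor_ext (fun _ _ => rfl)

/-- The product of sections `(E ⊗ 𝒪(k))(m) ⟶ E ⊗ 𝒪(k + m)`. -/
noncomputable def mulSec (k m n : ℤ) (hn : n = k + m) :
    (twist m).obj (sec.{u, w} V E k) ⟶ sec.{u, w} V E n :=
  (PresheafOfModules.sheafificationHomEquiv (𝟙 (structureSheaf V).obj)).symm (mulPre E k m n hn)

end Mul

section Bundles

variable {V : Type u} [AddCommGroup V] [Module ℂ V]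

variable (V) in
/-- The bilinear map `(u, v) ↦ u ∧ v`. -/
noncomputable def wedge : V →ₗ[ℂ] V →ₗ[ℂ] ⋀[ℂ]^2 V :=
  LinearMap.mk₂ ℂ (fun u v => exteriorPower.ιMulti ℂ 2 ![u, v])
    (fun u u' v => by
      have h (w : V) : Function.update ![0, v] 0 w = ![w, v] := by
        funext i; fin_cases i <;> rfl
      rw [← h, ← h u, ← h u', AlternatingMap.map_update_add])
    (fun c u v => by
      have h (w : V) : Function.update ![0, v] 0 w = ![w, v] := by
        funext i; fin_cases i <;> rfl
      rw [← h, ← h u, AlternatingMap.map_update_smul])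
    (fun u v v' => by
      have h (w : V) : Function.update ![u, 0] 1 w = ![u, w] := by
        funext i; fin_cases i <;> rfl
      rw [← h, ← h v, ← h v', AlternatingMap.map_update_add])
    (fun c u v => by
      have h (w : V) : Function.update ![u, 0] 1 w = ![u, w] := by
        funext i; fin_cases i <;> rfl
      rw [← h, ← h v, AlternatingMap.map_update_smul])

lemma wedge_apply (u v : V) : wedge V u v = exteriorPower.ιMulti ℂ 2 ![u, v] := rfl

lemma wedge_self (v : V) : wedge V v v = 0 :=
  (exteriorPower.ιMulti ℂ 2).map_eq_zero_of_eq ![v, v] (i := 0) (j := 1) rfl (by decide)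

/-- An alternating bilinear form, as a linear form on `⋀² V`: `u ∧ v ↦ f (u, v)`. -/
noncomputable def toLinearForm (f : V [⋀^Fin 2]→ₗ[ℂ] ℂ) : ⋀[ℂ]^2 V →ₗ[ℂ] ℂ :=
  exteriorPower.alternatingMapLinearEquiv f

/-- The form `f` is nondegenerate. -/
def Nondegenerate (f : V [⋀^Fin 2]→ₗ[ℂ] ℂ) : Prop :=
  ∀ u : V, (∀ v : V, f ![u, v] = 0) → u = 0

/-- The hyperplane `H` of `⋀² V` which corresponds to `f`. -/
noncomputable def kernelHyperplane (f : V [⋀^Fin 2]→ₗ[ℂ] ℂ) : Submodule ℂ (⋀[ℂ]^2 V) :=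
  LinearMap.ker (toLinearForm f)

/-- The Tango condition on a subspace `W` of `⋀² V`, where `dim V = 2n + 2`: the dimension of `W`
is `binom(2n + 2, 2) - 4n - 1`, and `W` contains no nonzero decomposable vector `u ∧ v`. -/
def TangoCondition (n : ℕ) (W : Submodule ℂ (⋀[ℂ]^2 V)) : Prop :=
  Module.finrank ℂ W + (4 * n + 1) = (2 * n + 2).choose 2 ∧
    ∀ u v : V, wedge V u v ∈ W → wedge V u v = 0

variable [FiniteDimensional ℂ V]

variable (V) in
/-- The tautological inclusion `g : 𝒪(-1) ⟶ V ⊗ 𝒪`, `a ↦ (v ↦ a v • v)`. -/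
noncomputable def tautInc : sec.{u, 0} V ℂ (-1) ⟶ sec.{u, u} V V 0 :=
  bilinSec.{u, 0, u} (LinearMap.lsmul ℂ V).flip (-1) 0 (by norm_num)

variable (V) in
/-- The quotient bundle `Q`, defined by `0 ⟶ 𝒪(-1) ⟶ V ⊗ 𝒪 ⟶ Q ⟶ 0`. -/
noncomputable def quotBundle : Mod V := cokernel (tautInc V)

/-- The morphism `ᵗg ∘ f : V ⊗ 𝒪 ⟶ 𝒪(1)`, `s ↦ (v ↦ f (s v, v))`. -/
noncomputable def evalForm (f : V [⋀^Fin 2]→ₗ[ℂ] ℂ) : sec.{u, u} V V 0 ⟶ sec.{u, 0} V ℂ 1 :=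
  bilinSec.{u, u, 0} ((wedge V).compr₂ (toLinearForm f)).flip 0 1 (by norm_num)

lemma tautInc_evalForm (f : V [⋀^Fin 2]→ₗ[ℂ] ℂ) : tautInc V ≫ evalForm f = 0 :=
  bilinSec_comp_eq_zero.{u, 0, u, 0} _ _ (fun v e => by
    simp [wedge_self]) _ _ _ _ _

/-- The morphism `Q ⟶ 𝒪(1)` induced by `ᵗg ∘ f`. -/
noncomputable def evalQuot (f : V [⋀^Fin 2]→ₗ[ℂ] ℂ) : quotBundle V ⟶ sec.{u, 0} V ℂ 1 :=
  cokernel.desc (tautInc V) (evalForm f) (tautInc_evalForm f)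

/-- The null-correlation bundle `N(f)`, defined by `0 ⟶ N(f) ⟶ Q ⟶ 𝒪(1) ⟶ 0`. -/
noncomputable def nullCorrelation (f : V [⋀^Fin 2]→ₗ[ℂ] ℂ) : Mod V := kernel (evalQuot f)

/-- The inclusion `N(f) ⟶ Q`. -/
noncomputable def nullCorrelationInc (f : V [⋀^Fin 2]→ₗ[ℂ] ℂ) :
    nullCorrelation f ⟶ quotBundle V := kernel.ι (evalQuot f)

/-- The morphism `V ⊗ 𝒪 ⟶ (⋀² V / W) ⊗ 𝒪(1)`, `s ↦ (v ↦ v ∧ s v mod W)`. -/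
noncomputable def wedgeForm (W : Submodule ℂ (⋀[ℂ]^2 V)) :
    sec.{u, u} V V 0 ⟶ sec.{u, u} V (⋀[ℂ]^2 V ⧸ W) 1 :=
  bilinSec.{u, u, u} ((wedge V).compr₂ W.mkQ) 0 1 (by norm_num)

lemma tautInc_wedgeForm (W : Submodule ℂ (⋀[ℂ]^2 V)) : tautInc V ≫ wedgeForm W = 0 :=
  bilinSec_comp_eq_zero.{u, 0, u, u} _ _ (fun v e => by
    simp [wedge_self]) _ _ _ _ _

/-- The morphism `Q ⟶ (⋀² V / W) ⊗ 𝒪(1)` induced by `wedgeForm W`. -/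
noncomputable def wedgeQuot (W : Submodule ℂ (⋀[ℂ]^2 V)) :
    quotBundle V ⟶ sec.{u, u} V (⋀[ℂ]^2 V ⧸ W) 1 :=
  cokernel.desc (tautInc V) (wedgeForm W) (tautInc_wedgeForm W)

/-- The morphism `ϖ_W : Q(-1) ⟶ (⋀² V / W) ⊗ 𝒪`; in the fibre at the line spanned by `v`
it is `[u] ⊗ v ↦ v ∧ u mod W`. -/
noncomputable def tangoMap (W : Submodule ℂ (⋀[ℂ]^2 V)) :
    (twist (-1)).obj (quotBundle V) ⟶ sec.{u, u} V (⋀[ℂ]^2 V ⧸ W) 0 :=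
  (twist (-1)).map (wedgeQuot W) ≫ mulSec.{u, u} (⋀[ℂ]^2 V ⧸ W) 1 (-1) 0 (by norm_num)

/-- `F`, with the morphism `p`, is the Tango bundle `F(W)`: the sequence
`Q(-1) ⟶ (⋀² V / W) ⊗ 𝒪 ⟶ F(1) ⟶ 0` given by `ϖ_W` and `p` is exact.
(The injectivity of `ϖ_W` is not required here.) -/
structure IsTangoBundle (W : Submodule ℂ (⋀[ℂ]^2 V)) (F : Mod V)
    (p : sec.{u, u} V (⋀[ℂ]^2 V ⧸ W) 0 ⟶ (twist 1).obj F) : Prop where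
  comp_eq_zero : tangoMap W ≫ p = 0
  exact : (ShortComplex.mk (tangoMap W) p comp_eq_zero).Exact
  epi : Epi p

/-- The space `H / W`, as a subspace of `⋀² V / W` (for `W` contained in `H`). -/
def hyperplaneQuot (W H : Submodule ℂ (⋀[ℂ]^2 V)) : Submodule ℂ (⋀[ℂ]^2 V ⧸ W) :=
  H.map W.mkQ

/-- The inclusion `(H / W) ⊗ 𝒪 ⟶ (⋀² V / W) ⊗ 𝒪`. -/
noncomputable def hyperplaneInc (W H : Submodule ℂ (⋀[ℂ]^2 V)) :
    sec.{u, u} V (hyperplaneQuot W H) 0 ⟶ sec.{u, u} V (⋀[ℂ]^2 V ⧸ W) 0 :=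
  mapSec.{u, u, u} (hyperplaneQuot W H).subtype 0

end Bundles
end ProjBundle

/-!
Let `q : ⋀² V / W → ℂ` be the linear form induced by `f`; its kernel is `H / W`. As
`f (v, u) = -f (u, v)`, the composite of `ϖ_W` with `q ⊗ 𝒪` is, up to sign, the twist by `𝒪(-1)` of
the morphism `Q ⟶ 𝒪(1)` induced by `f` (`tangoMap_mapSec`). So `ϖ_W` is a morphism between the
extensions

  `0 ⟶ N(f)(-1) ⟶ Q(-1) ⟶ 𝒪 ⟶ 0` and `0 ⟶ (H / W) ⊗ 𝒪 ⟶ (⋀² V / W) ⊗ 𝒪 ⟶ 𝒪 ⟶ 0`,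

which is the identity on `𝒪`, and the snake lemma (in the form `exists_shortExact_of_factor`) says
that it and its restriction to the kernels have the same cokernel, namely `F(W)(1)`.

Four facts about sheaves feed this argument.
* Exactness can be checked on the sections over small open sets (`exact_of_locally_exact`), also
  before sheafification (`exact_sheafification`), because sheafification is exact.
* Twisting preserves left exact sequences (`twist_exact_of_mono`): where a linear form `l` does not
  vanish, `l ^ k` is a basis of `𝒪(k)`, so `𝒪(k)` is flat there. For the same reason the product
  `(E ⊗ 𝒪(k))(m) ⟶ E ⊗ 𝒪(k + m)` is an isomorphism (`isIso_mulSec`).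
* `ϖ_W` is a monomorphism (`tangoMap_mono`): if `v ∧ s v ∈ W` then `v ∧ s v = 0` by the Tango
  condition, so `s v` is a multiple of `v`, that is, `s` comes from `𝒪(-1)`.
* `Q(-1) ⟶ 𝒪` is an epimorphism (`epi_tangoMap_mapSec`): `f` is nondegenerate, so every point of
  `ℙ(V)` has a neighbourhood on which some linear form `f (w, ·)` does not vanish.
-/

open scoped ZeroObject

namespace ProjBundle

/-! ### Sheaves of modules and sheafification -/

section Local

variable {X : TopCat.{u}} {R : Sheaf (Opens.grothendieckTopology X) RingCat.{u}}

/-- The zero presheaf maps to a locally zero presheaf by a locally bijective morphism, which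
sheafification inverts. -/
lemma isZero_sheafification_of_locally_isZero (M : PresheafOfModules.{u} R.obj)
    (h : ∀ x : X, ∃ U : Opens X, x ∈ U ∧ ∀ U' ≤ U, IsZero (M.obj (.op U'))) :
    IsZero ((PresheafOfModules.sheafification (𝟙 R.obj)).obj M) := by
  let J := Opens.grothendieckTopology X
  let Z : (Opens X)ᵒᵖ ⥤ Ab.{u} := (Functor.const _).obj (AddCommGrpCat.of PUnit)
  have hZ : IsZero Z := (Functor.isZero_iff _).2 fun _ =>
    AddCommGrpCat.isZero_of_subsingleton (AddCommGrpCat.of PUnit)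
  let φ : Z ⟶ M.presheaf := 0
  have h1 : Presheaf.IsLocallySurjective J φ := by
    refine ⟨fun {U} s x hx => ?_⟩
    obtain ⟨U', hxU', h0⟩ := h x
    refine ⟨U ⊓ U', homOfLE inf_le_left, ⟨0, ?_⟩, hx, hxU'⟩
    have := ModuleCat.subsingleton_of_isZero (h0 (U ⊓ U') inf_le_right)
    exact Subsingleton.elim (α := M.obj (.op (U ⊓ U'))) _ _
  have h2 : Presheaf.IsLocallyInjective J φ := by
    refine ⟨fun {U} s t _ => ?_⟩
    obtain rfl : s = t := Subsingleton.elim (α := PUnit) s t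
    rw [Presheaf.equalizerSieve_self_eq_top]
    exact J.top_mem _
  have h3 : IsIso ((presheafToSheaf J Ab.{u}).map φ) := by
    rw [← GrothendieckTopology.W_iff, GrothendieckTopology.W_iff_isLocallyBijective]
    exact ⟨h2, h1⟩
  have h4 : IsZero ((presheafToSheaf J Ab.{u}).obj M.presheaf) :=
    IsZero.of_iso ((presheafToSheaf J Ab.{u}).map_isZero hZ)
      (asIso ((presheafToSheaf J Ab.{u}).map φ)).symm
  rw [IsZero.iff_id_eq_zero] at h4 ⊢
  apply (SheafOfModules.toSheaf R).map_injective
  exact h4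

/-- Sheafification is exact, so it commutes with homology; where the sequence is exact on sections
the homology presheaf vanishes. -/
lemma exact_sheafification (S : ShortComplex (PresheafOfModules.{u} R.obj))
    (h : ∀ x : X, ∃ U : Opens X, x ∈ U ∧
      ∀ U' ≤ U, (S.map (PresheafOfModules.evaluation R.obj (.op U'))).Exact) :
    (S.map (PresheafOfModules.sheafification (𝟙 R.obj))).Exact := by
  rw [ShortComplex.exact_iff_isZero_homology]
  refine IsZero.of_iso (isZero_sheafification_of_locally_isZero S.homology fun x => ?_)
    (S.mapHomologyIso (PresheafOfModules.sheafification (𝟙 R.obj)))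
  obtain ⟨U, hx, hU⟩ := h x
  refine ⟨U, hx, fun U' hU' => ?_⟩
  have := hU U' hU'
  rw [ShortComplex.exact_iff_isZero_homology] at this
  exact this.of_iso (S.mapHomologyIso (PresheafOfModules.evaluation R.obj (.op U'))).symm

lemma exact_of_locally_exact (S : ShortComplex (SheafOfModules.{u} R))
    (h : ∀ x : X, ∃ U : Opens X, x ∈ U ∧ ∀ U' ≤ U,
      Function.Exact (S.f.val.app (.op U')) (S.g.val.app (.op U'))) : S.Exact := by
  have h1 := exact_sheafification (S.map (SheafOfModules.forget R)) fun x => by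
    obtain ⟨U, hx, hU⟩ := h x
    exact ⟨U, hx, fun U' hU' =>
      (ShortComplex.ShortExact.moduleCat_exact_iff_function_exact _).2 (hU U' hU')⟩
  let adj := PresheafOfModules.sheafificationAdjunction (𝟙 R.obj)
  exact (ShortComplex.exact_iff_of_iso (S.mapNatIso (asIso adj.counit))).1 h1

/-- The left exactness of the functors of sections. -/
lemma exact_sections (S : ShortComplex (SheafOfModules.{u} R)) (hS : S.Exact) [Mono S.f]
    (U : (Opens X)ᵒᵖ) : Function.Exact (S.f.val.app U) (S.g.val.app U) := by
  have := hS.map_of_mono_of_preservesKernel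
    (SheafOfModules.forget R ⋙ PresheafOfModules.evaluation R.obj U)
    inferInstance inferInstance
  rwa [ShortComplex.ShortExact.moduleCat_exact_iff_function_exact] at this

/-- The bijection `sheafificationHomEquiv` is the one of the adjunction, so that its naturality can
be used; by definition only the two forward maps agree. -/
lemma sheafificationHomEquiv_symm_eq {P : PresheafOfModules.{u} R.obj} {M : SheafOfModules.{u} R}
    (φ : P ⟶ M.val) :
    (PresheafOfModules.sheafificationHomEquiv (𝟙 R.obj) (F := M)).symm φ =
      ((PresheafOfModules.sheafificationAdjunction (𝟙 R.obj)).homEquiv P M).symm φ :=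
  (Equiv.symm_apply_eq _).2 (((Equiv.symm_apply_eq _).1 rfl).trans
      (PresheafOfModules.sheafificationAdjunction_homEquiv_apply _ _))

/-- A locally bijective morphism from a presheaf of modules to a sheaf of modules induces an
isomorphism on the associated sheaf. -/
lemma isIso_sheafificationHomEquiv_symm {P : PresheafOfModules.{u} R.obj}
    {M : SheafOfModules.{u} R} (φ : P ⟶ M.val)
    (h : ∀ x : X, ∃ U : Opens X, x ∈ U ∧ ∀ U' ≤ U, Function.Bijective (φ.app (.op U'))) :
    IsIso ((PresheafOfModules.sheafificationHomEquiv (𝟙 R.obj) (F := M)).symm φ) := by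
  let a := PresheafOfModules.sheafification (𝟙 R.obj)
  let adj := PresheafOfModules.sheafificationAdjunction (𝟙 R.obj)
  have h1 := exact_sheafification (ShortComplex.mk (0 : P ⟶ P) φ zero_comp) fun x => by
    obtain ⟨U, hx, hU⟩ := h x
    refine ⟨_, hx, fun U' hU' => ?_⟩
    rw [ShortComplex.ShortExact.moduleCat_exact_iff_function_exact]
    exact fun t => ⟨fun ht => ⟨0, ((injective_iff_map_eq_zero _).1 (hU U' hU').1 t ht).symm⟩,
      by rintro ⟨_, rfl⟩; exact map_zero (φ.app (.op U')).hom⟩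
  have h2 := exact_sheafification (ShortComplex.mk φ (0 : M.val ⟶ M.val) comp_zero) fun x => by
    obtain ⟨U, hx, hU⟩ := h x
    refine ⟨_, hx, fun U' hU' => ?_⟩
    rw [ShortComplex.ShortExact.moduleCat_exact_iff_function_exact]
    exact fun t => ⟨fun _ => (hU U' hU').2 t, fun _ => rfl⟩
  have h3 : Mono (a.map φ) := (ShortComplex.exact_iff_mono _ (a.map_zero _ _)).1 h1
  have h4 : Epi (a.map φ) := (ShortComplex.exact_iff_epi _ (a.map_zero _ _)).1 h2
  have h5 : IsIso (a.map φ) := isIso_of_mono_of_epi _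
  have h6 : IsIso (adj.counit.app M) := inferInstance
  exact ((sheafificationHomEquiv_symm_eq φ).trans (adj.homEquiv_counit P M φ)) ▸
    IsIso.comp_isIso' h5 h6

lemma map_comp_sheafificationHomEquiv_symm {P P' : PresheafOfModules.{u} R.obj}
    {M : SheafOfModules.{u} R} (ψ : P' ⟶ P) (φ : P ⟶ M.val) :
    (PresheafOfModules.sheafification (𝟙 R.obj)).map ψ ≫
      (PresheafOfModules.sheafificationHomEquiv (𝟙 R.obj) (F := M)).symm φ =
      (PresheafOfModules.sheafificationHomEquiv (𝟙 R.obj) (F := M)).symm (ψ ≫ φ) := by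
  have h := (PresheafOfModules.sheafificationAdjunction (𝟙 R.obj)).homEquiv_naturality_left_symm
    (Y := M) ψ φ
  rw [sheafificationHomEquiv_symm_eq φ]
  exact h.symm.trans (sheafificationHomEquiv_symm_eq (ψ ≫ φ)).symm

lemma sheafificationHomEquiv_symm_comp {P : PresheafOfModules.{u} R.obj}
    {M N : SheafOfModules.{u} R} (φ : P ⟶ M.val) (g : M ⟶ N) :
    (PresheafOfModules.sheafificationHomEquiv (𝟙 R.obj) (F := M)).symm φ ≫ g =
      (PresheafOfModules.sheafificationHomEquiv (𝟙 R.obj) (F := N)).symm (φ ≫ g.val) := by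
  have h := (PresheafOfModules.sheafificationAdjunction (𝟙 R.obj)).homEquiv_naturality_right_symm
    (X := P) (Y := M) φ g
  rw [sheafificationHomEquiv_symm_eq φ]
  exact h.symm.trans (sheafificationHomEquiv_symm_eq (φ ≫ g.val)).symm

end Local

/-! ### Trivialization of the line bundles -/

section Trivialization

variable {V : Type u} [AddCommGroup V] [Module ℂ V]

lemma dual_mem_polyFun (l : Module.Dual ℂ V) : (l : V → ℂ) ∈ polyFun V :=
  Algebra.subset_adjoin ⟨l, rfl⟩

/-- The open set of the lines on which the linear form `l` does not vanish. -/
def basicOpen (l : Module.Dual ℂ V) : Opens (PSpace V) :=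
  ⟨nonvanishing l, TopologicalSpace.isOpen_generateFrom_of_mem
    ⟨l, dual_mem_polyFun l, 1, fun c v _ => by simp, rfl⟩⟩

lemma ne_zero_of_mem_basicOpen {l : Module.Dual ℂ V} {x : PSpace V} (hx : x ∈ basicOpen l)
    (v : Punctured x) : l v.1 ≠ 0 := hx v.1 v.2.1 v.2.2

lemma mem_basicOpen_of_ne_zero {l : Module.Dual ℂ V} {x : PSpace V} (v : Punctured x)
    (h : l v.1 ≠ 0) : x ∈ basicOpen l := by
  intro w hw hw0
  have hx := v.2.1
  have key (y : ℙ ℂ V) : ∀ z ∈ y.submodule, ∃ a : ℂ, a • y.rep = z := fun z hz => by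
    rwa [y.submodule_eq, Submodule.mem_span_singleton] at hz
  obtain ⟨a, rfl⟩ := key x w hw
  obtain ⟨b, hb⟩ := key x v.1 hx
  rw [← hb, map_smul, smul_eq_mul] at h
  rw [map_smul, smul_eq_mul]
  exact mul_ne_zero (fun h0 => hw0 (by simp [h0])) (right_ne_zero_of_mul h)

instance (x : PSpace V) : Nonempty (Punctured x) :=
  have key (y : ℙ ℂ V) : y.rep ∈ y.submodule := by
    rw [y.submodule_eq]; exact Submodule.mem_span_singleton_self _
  ⟨⟨Projectivization.rep (K := ℂ) (V := V) x, key x, Projectivization.rep_nonzero _⟩⟩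

lemma exists_mem_basicOpen (x : PSpace V) : ∃ l : Module.Dual ℂ V, x ∈ basicOpen l := by
  obtain ⟨v⟩ : Nonempty (Punctured x) := inferInstance
  obtain ⟨l, hl⟩ : ∃ l : Module.Dual ℂ V, l v.1 ≠ 0 := by
    by_contra! h
    exact v.2.2 ((Module.forall_dual_apply_eq_zero_iff ℂ v.1).1 h)
  exact ⟨l, mem_basicOpen_of_ne_zero v hl⟩

lemma isRegular_zpow (l : Module.Dual ℂ V) (k : ℤ) {U : Opens (PSpace V)} (hU : U ≤ basicOpen l) :
    (isRegular V ℂ k).pred (fun (x : U) (v : Punctured x.1) => l v.1 ^ k) := by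
  have hom (m : ℕ) : IsHomog (m : ℤ) ((l : V → ℂ) ^ m) := fun c v _ => by
    simp [mul_pow]
  refine fun x => ⟨U, x.2, 𝟙 U, (-k).toNat, (l : V → ℂ) ^ k.toNat,
    le_vecPoly (pow_mem (dual_mem_polyFun l) _), (l : V → ℂ) ^ (-k).toNat,
    pow_mem (dual_mem_polyFun l) _, ?_, hom _, fun y v => ?_⟩
  · have : ((-k).toNat : ℤ) + k = k.toNat := by omega
    rw [this]
    exact hom _
  · have h0 := ne_zero_of_mem_basicOpen (hU y.2) v
    refine ⟨pow_ne_zero _ h0, ?_⟩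
    have : k = -((-k).toNat : ℤ) + (k.toNat : ℤ) := by omega
    change l v.1 ^ k = ((l v.1) ^ (-k).toNat)⁻¹ * (l v.1) ^ k.toNat
    conv_lhs => rw [this, zpow_add₀ h0, zpow_neg, zpow_natCast, zpow_natCast]

/-- The section `l ^ k` of `𝒪(k)`, over an open set on which `l` does not vanish. -/
noncomputable def zpowSection (l : Module.Dual ℂ V) (k : ℤ) {U : Opens (PSpace V)}
    (hU : U ≤ basicOpen l) : regSections V ℂ k U :=
  ⟨fun _ v => l v.1 ^ k, isRegular_zpow l k hU⟩

/-- The section `l ^ k` trivializes `𝒪(k)` where `l` does not vanish. -/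
noncomputable def zpowTrivialization (l : Module.Dual ℂ V) (k : ℤ) {U : Opens (PSpace V)}
    (hU : U ≤ basicOpen l) : regRing V U ≃ₗ[regRing V U] regSections V ℂ k U where
  toFun r := r • zpowSection l k hU
  map_add' r s := add_smul _ _ _
  map_smul' r s := mul_smul _ _ _
  invFun s := ⟨fun x v => l v.1 ^ (-k) * s.1 x v,
    isRegular_smul (by ring) (isRegular_zpow l (-k) hU) s.2⟩
  left_inv r := by
    ext x v
    have h0 := ne_zero_of_mem_basicOpen (hU x.2) v
    change l v.1 ^ (-k) * (r.1 x v * l v.1 ^ k) = r.1 x v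
    rw [mul_left_comm, ← zpow_add₀ h0]
    simp
  right_inv s := by
    ext x v
    have h0 := ne_zero_of_mem_basicOpen (hU x.2) v
    change l v.1 ^ (-k) * s.1 x v * l v.1 ^ k = s.1 x v
    rw [mul_right_comm, ← zpow_add₀ h0]
    simp

lemma flat_regSections (l : Module.Dual ℂ V) (k : ℤ) {U : Opens (PSpace V)}
    (hU : U ≤ basicOpen l) : Module.Flat (regRing V U) (regSections V ℂ k U) :=
  Module.Flat.of_linearEquiv (zpowTrivialization l k hU).symm

end Trivialization

/-! ### Exactness of the twist -/

section Twist

variable {V : Type u} [AddCommGroup V] [Module ℂ V]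

variable (V) in
/-- The presheaf-level twist `M ↦ (U ↦ M(U) ⊗ 𝒪(k)(U))`. -/
noncomputable def preTwist (k : ℤ) : PresheafOfModules.{u} (structureSheaf V).obj ⥤
    PresheafOfModules.{u} (structureSheaf V).obj :=
  MonoidalCategory.tensorRight
    (C := PresheafOfModules.{u} (structurePresheaf V ⋙ forget₂ CommRingCat RingCat))
    (sec.{u, 0} V ℂ k).val

instance (k : ℤ) : (preTwist V k).PreservesZeroMorphisms where
  map_zero M N := by
    apply PresheafOfModules.hom_ext
    intro U
    exact ModuleCat.MonoidalCategory.tensor_ext (fun _ _ => TensorProduct.zero_tmul _ _)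

instance : (SheafOfModules.forget (structureSheaf V)).PreservesZeroMorphisms where
  map_zero _ _ := rfl

instance (k : ℤ) :
    (SheafOfModules.forget (structureSheaf V) ⋙ preTwist V k).PreservesZeroMorphisms where
  map_zero M N := (preTwist V k).map_zero M.val N.val

instance (k : ℤ) : (twist (V := V) k).PreservesZeroMorphisms where
  map_zero M N := by
    change (PresheafOfModules.sheafification (𝟙 (structureSheaf V).obj)).map
      ((preTwist V k).map (0 : M.val ⟶ N.val)) = 0
    rw [Functor.map_zero, Functor.map_zero]

/-- `𝒪(k)(U)` is flat over the ring of regular functions when `U` is small, so the presheaf-level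
twist keeps the sequence exact on small open sets. -/
lemma twist_exact (k : ℤ) (S : ShortComplex (Mod V))
    (h : ∀ U, Function.Exact (S.f.val.app U) (S.g.val.app U)) :
    (S.map (twist k)).Exact := by
  refine exact_sheafification (S.map (SheafOfModules.forget _ ⋙ preTwist V k)) fun x => ?_
  obtain ⟨l, hl⟩ := exists_mem_basicOpen x
  refine ⟨_, hl, fun U hU => ?_⟩
  rw [ShortComplex.ShortExact.moduleCat_exact_iff_function_exact]
  have : Module.Flat ((structurePresheaf V).obj (.op U)) ((sec.{u, 0} V ℂ k).val.obj (.op U)) :=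
    flat_regSections l k hU
  exact Module.Flat.rTensor_exact (R := (structurePresheaf V).obj (.op U)) _ (h (.op U))

/-- Surjectivity is asked on all small open sets, so that it passes to the tensor products
of sections. -/
lemma twist_epi (k : ℤ) {M N : Mod V} (φ : M ⟶ N)
    (h : ∀ x : PSpace V, ∃ U : Opens (PSpace V), x ∈ U ∧ ∀ U' ≤ U,
      Function.Surjective (φ.val.app (.op U'))) : Epi ((twist k).map φ) := by
  have := exact_sheafification (ShortComplex.mk ((preTwist V k).map φ.val)
      (0 : _ ⟶ (preTwist V k).obj N.val) comp_zero) fun x => by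
    obtain ⟨U, hx, hU⟩ := h x
    refine ⟨U, hx, fun U' hU' => ?_⟩
    rw [ShortComplex.ShortExact.moduleCat_exact_iff_function_exact]
    intro t
    exact ⟨fun _ => LinearMap.rTensor_surjective (R := (structurePresheaf V).obj (.op U')) _
      (hU U' hU') t, fun _ => rfl⟩
  exact (ShortComplex.exact_iff_epi _
    ((PresheafOfModules.sheafification (𝟙 (structureSheaf V).obj)).map_zero _ _)).1 this

lemma twist_exact_of_mono (k : ℤ) (S : ShortComplex (Mod V)) (hS : S.Exact) [Mono S.f] :
    (S.map (twist k)).Exact :=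
  twist_exact k S (exact_sections S hS)

lemma twist_mono (k : ℤ) {M N : Mod V} (φ : M ⟶ N) [Mono φ] : Mono ((twist k).map φ) := by
  let S := ShortComplex.mk (0 : 0 ⟶ M) φ zero_comp
  have : Mono S.f := inferInstanceAs (Mono (0 : 0 ⟶ M))
  have hS : S.Exact := (S.exact_iff_mono rfl).2 inferInstance
  exact ((S.map (twist k)).exact_iff_mono ((twist k).map_zero _ _)).1 (twist_exact_of_mono k S hS)

end Twist

/-! ### Products of sections -/

section Mul

variable {V : Type (max u w)} [AddCommGroup V] [Module ℂ V]
variable (E : Type w) [AddCommGroup E] [Module ℂ E]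

/-- Where `l ≠ 0`, every element of the tensor product of sections is `s ⊗ l ^ m`. -/
lemma exists_eq_tmul_zpowSection (k m : ℤ) (l : Module.Dual ℂ V) {U : Opens (PSpace V)}
    (hU : U ≤ basicOpen l)
    (t : TensorProduct (regRing V U) (regSections V E k U) (regSections V ℂ m U)) :
    ∃ s, t = TensorProduct.tmul (regRing V U) s (zpowSection l m hU) := by
  induction t with
  | zero => exact ⟨0, (TensorProduct.zero_tmul _ _).symm⟩
  | tmul s a =>
    obtain ⟨r, rfl⟩ := (zpowTrivialization l m hU).surjective a
    exact ⟨r • s, (TensorProduct.smul_tmul r s (zpowSection l m hU)).symm⟩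
  | add t t' h h' =>
    obtain ⟨s, rfl⟩ := h
    obtain ⟨s', rfl⟩ := h'
    exact ⟨s + s', (TensorProduct.add_tmul _ _ _).symm⟩

lemma mulPre_app_injective (k m n : ℤ) (hn : n = k + m) (l : Module.Dual ℂ V)
    {U : Opens (PSpace V)} (hU : U ≤ basicOpen l) :
    Function.Injective ((mulPre.{u, w} E k m n hn).app (.op U)) := by
  refine (injective_iff_map_eq_zero _).2 fun t ht => ?_
  obtain ⟨s, rfl⟩ := exists_eq_tmul_zpowSection.{u, w} E k m l hU t
  obtain rfl : s = 0 := by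
    ext x v
    have h1 := congrFun (congrFun (congrArg Subtype.val ht) x) v
    exact (smul_eq_zero.1 h1).resolve_left
      (zpow_ne_zero _ (ne_zero_of_mem_basicOpen (hU x.2) v))
  exact TensorProduct.zero_tmul _ _

lemma mulPre_app_surjective (k m n : ℤ) (hn : n = k + m) (l : Module.Dual ℂ V)
    {U : Opens (PSpace V)} (hU : U ≤ basicOpen l) :
    Function.Surjective ((mulPre.{u, w} E k m n hn).app (.op U)) := by
  intro (s : regSections V E n U)
  let t : TensorProduct (regRing V U) (regSections V E k U) (regSections V ℂ m U) :=
    TensorProduct.tmul (regRing V U) (⟨fun x v => l v.1 ^ (-m) • s.1 x v,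
      isRegular_smul (by omega) (isRegular_zpow l (-m) hU) s.2⟩ : regSections V E k U)
      (zpowSection l m hU)
  refine ⟨t, ?_⟩
  refine Subtype.ext (funext fun x => funext fun v => ?_)
  have h0 := ne_zero_of_mem_basicOpen (hU x.2) v
  change l v.1 ^ m • l v.1 ^ (-m) • s.1 x v = s.1 x v
  rw [smul_smul, ← zpow_add₀ h0]
  simp

instance isIso_mulSec (k m n : ℤ) (hn : n = k + m) :
    IsIso (mulSec.{u, w} (V := V) E k m n hn) := by
  refine isIso_sheafificationHomEquiv_symm (R := structureSheaf V)
    (P := (preTwist V m).obj (sec.{u, w} V E k).val) (M := sec.{u, w} V E n)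
    (mulPre.{u, w} (V := V) E k m n hn) fun x => ?_
  obtain ⟨l, hl⟩ := exists_mem_basicOpen x
  exact ⟨_, hl, fun U hU => ⟨mulPre_app_injective.{u, w} E k m n hn l hU,
    mulPre_app_surjective.{u, w} E k m n hn l hU⟩⟩

end Mul

/-! ### Constant linear maps -/

section MapSec

/-- The naturality of `(E ⊗ 𝒪(k))(m) ⟶ E ⊗ 𝒪(k + m)` in `E`. -/
lemma twist_map_mapSec_mulSec {V : Type (max u w w')} [AddCommGroup V] [Module ℂ V]
    {E : Type w} [AddCommGroup E] [Module ℂ E] {E' : Type w'} [AddCommGroup E'] [Module ℂ E']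
    (L : E →ₗ[ℂ] E') (k m n : ℤ) (hn : n = k + m) :
    (twist m).map (mapSec.{u, w, w'} (V := V) L k) ≫ mulSec.{max u w, w'} E' k m n hn =
      mulSec.{max u w', w} E k m n hn ≫ mapSec.{u, w, w'} L n := by
  refine (map_comp_sheafificationHomEquiv_symm (R := structureSheaf V)
    ((preTwist V m).map (mapSec.{u, w, w'} (V := V) L k).val)
      (mulPre.{max u w, w'} E' k m n hn)).trans
    (Eq.trans ?_ (sheafificationHomEquiv_symm_comp (R := structureSheaf V)
      (mulPre.{max u w', w} E k m n hn) (mapSec.{u, w, w'} (V := V) L n)).symm)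
  congr 1
  apply PresheafOfModules.hom_ext
  intro U
  refine ModuleCat.MonoidalCategory.tensor_ext (fun s a => ?_)
  exact Subtype.ext (funext fun x => funext fun v => (map_smul L _ _).symm)

section

variable {V : Type (max u w)} [AddCommGroup V] [Module ℂ V] {E E' : Type u} {E'' : Type w}
  [AddCommGroup E] [Module ℂ E] [AddCommGroup E'] [Module ℂ E'] [AddCommGroup E''] [Module ℂ E'']

lemma mapSec_comp_eq_zero (L : E →ₗ[ℂ] E') (L' : E' →ₗ[ℂ] E'') (h : ∀ e, L' (L e) = 0) (k : ℤ) :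
    mapSec.{max u w, u, u} (V := V) L k ≫ mapSec.{u, u, w} L' k = 0 := by
  apply SheafOfModules.hom_ext
  apply PresheafOfModules.hom_ext
  intro U
  apply ModuleCat.hom_ext
  apply LinearMap.ext
  intro s
  exact Subtype.ext (funext fun x => funext fun v => h _)

lemma mapSec_exact (L : E →ₗ[ℂ] E') (L' : E' →ₗ[ℂ] E'') (hL : Function.Injective L)
    (h : Function.Exact L L') (k : ℤ) :
    (ShortComplex.mk _ _ (mapSec_comp_eq_zero.{u, w} (V := V) L L'
      h.apply_apply_eq_zero k)).Exact := by
  refine exact_of_locally_exact _ fun x => ⟨⊤, trivial, fun U _ => ?_⟩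
  -- Composing with a linear retraction `r` of `L` gives a regular preimage.
  obtain ⟨r, hr⟩ := L.exists_leftInverse_of_injective (LinearMap.ker_eq_bot.2 hL)
  intro (s : regSections V E' k U)
  constructor
  · intro hs
    refine ⟨(⟨fun x v => r (s.1 x v), isRegular_comp r s.2⟩ : regSections V E k U), ?_⟩
    refine Subtype.ext (funext fun x => funext fun v => ?_)
    have h1 : L' (s.1 x v) = 0 := congrFun (congrFun (congrArg Subtype.val hs) x) v
    obtain ⟨e, he⟩ := (h _).1 h1
    change L (r (s.1 x v)) = s.1 x v
    rw [← he]
    exact congrArg L (LinearMap.congr_fun hr e)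
  · rintro ⟨t, rfl⟩
    exact Subtype.ext (funext fun x => funext fun v => h.apply_apply_eq_zero _)

lemma mapSec_mono (L : E →ₗ[ℂ] E') (hL : Function.Injective L) (k : ℤ) :
    Mono (mapSec.{max u w, u, u} (V := V) L k) := by
  obtain ⟨r, hr⟩ := L.exists_leftInverse_of_injective (LinearMap.ker_eq_bot.2 hL)
  have : mapSec.{max u w, u, u} (V := V) L k ≫ mapSec.{max u w, u, u} r k = 𝟙 _ := by
    apply SheafOfModules.hom_ext
    apply PresheafOfModules.hom_ext
    intro U
    apply ModuleCat.hom_ext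
    apply LinearMap.ext
    intro s
    exact Subtype.ext (funext fun x => funext fun v => LinearMap.congr_fun hr _)
  exact mono_of_mono_fac this

end

end MapSec

/-! ### A diagram lemma in abelian categories -/

section Abstract

/-- In the diagram with exact rows `0 ⟶ N ⟶ Q ⟶ L ⟶ 0` and `0 ⟶ H ⟶ A ⟶ L ⟶ 0`, with `ϖ : Q ⟶ A`
over the identity of `L`, the monomorphism `ϖ` restricts to `i : N ⟶ H`, and `i` has the same
cokernel as `ϖ`. -/
lemma exists_shortExact_of_factor {C : Type*} [Category* C] [Abelian C] {N Q A L H F : C}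
    (a : N ⟶ Q) (ϖ : Q ⟶ A) (q : A ⟶ L) (j : H ⟶ A) (p : A ⟶ F) [Mono a] [Mono ϖ] [Mono j]
    [Epi p] [Epi (ϖ ≫ q)]
    (w₁ : a ≫ ϖ ≫ q = 0) (h₁ : (ShortComplex.mk a (ϖ ≫ q) w₁).Exact)
    (w₂ : j ≫ q = 0) (h₂ : (ShortComplex.mk j q w₂).Exact)
    (w₃ : ϖ ≫ p = 0) (h₃ : (ShortComplex.mk ϖ p w₃).Exact) :
    ∃ (i : N ⟶ H) (w : i ≫ j ≫ p = 0), i ≫ j = a ≫ ϖ ∧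
      (ShortComplex.mk i (j ≫ p) w).ShortExact := by
  have hq : Epi q := epi_of_epi ϖ q
  let i : N ⟶ H := h₂.lift (a ≫ ϖ) (by simpa using w₁)
  have hi : i ≫ j = a ≫ ϖ := h₂.lift_f _ _
  have w : i ≫ j ≫ p = 0 := by rw [reassoc_of% hi, w₃, comp_zero]
  have hmi : Mono i := mono_of_mono_fac hi
  have hep : Epi (j ≫ p) := by
    rw [Preadditive.epi_iff_cancel_zero]
    intro T c hc
    have e1 : j ≫ p ≫ c = 0 := by simpa using hc
    let d : L ⟶ T := h₂.desc (p ≫ c) e1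
    have hd : q ≫ d = p ≫ c := h₂.g_desc _ _
    have e2 : (ϖ ≫ q) ≫ d = 0 := by rw [Category.assoc, hd, reassoc_of% w₃, zero_comp]
    have e3 : d = 0 := (cancel_epi (ϖ ≫ q)).1 (by rw [e2, comp_zero])
    rw [← cancel_epi p, ← hd, e3, comp_zero, comp_zero]
  refine ⟨i, w, hi, ?_⟩
  refine { exact := ?_, mono_f := hmi, epi_g := hep }
  refine ShortComplex.exact_of_f_is_kernel _ (KernelFork.IsLimit.ofι' _ _ fun {T} x hx => ?_)
  let y : T ⟶ Q := h₃.lift (x ≫ j) (by simpa using hx)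
  have hy : y ≫ ϖ = x ≫ j := h₃.lift_f _ _
  have hyq : y ≫ ϖ ≫ q = 0 := by rw [reassoc_of% hy, w₂, comp_zero]
  refine ⟨h₁.lift y hyq, ?_⟩
  have hz : h₁.lift y hyq ≫ a = y := h₁.lift_f _ _
  rw [← cancel_mono j]
  change (h₁.lift y hyq ≫ i) ≫ j = _
  rw [Category.assoc, hi, reassoc_of% hz, hy]

end Abstract

/-! ### The Tango and null-correlation bundles -/

section Bundles

variable {V : Type u} [AddCommGroup V] [Module ℂ V]

/-- If `v ∧ w = 0` and `l v ≠ 0` then `w = (l w / l v) v`: for each linear form `m`, the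
alternating form `(u, u') ↦ l u * m u' - m u * l u'` takes the value `0` at `(v, w)`. -/
lemma eq_smul_of_wedge_eq_zero {v w : V} (h : wedge V v w = 0) {l : Module.Dual ℂ V}
    (hl : l v ≠ 0) : w = ((l v) ^ (-1 : ℤ) * l w) • v := by
  rw [← sub_eq_zero, ← Module.forall_dual_apply_eq_zero_iff ℂ]
  intro m
  let α : V [⋀^Fin 2]→ₗ[ℂ] ℂ := Matrix.detRowAlternating.compLinearMap (LinearMap.pi ![l, m])
  have h1 : α ![v, w] = 0 := by
    have := congrArg (exteriorPower.alternatingMapLinearEquiv α) h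
    rwa [wedge_apply, exteriorPower.alternatingMapLinearEquiv_apply_ιMulti, map_zero] at this
  have h2 : l v * m w - m v * l w = 0 := by
    have h3 : α ![v, w] = Matrix.det (Matrix.of fun i j => (![l, m] j) (![v, w] i)) := rfl
    rw [h3, Matrix.det_fin_two] at h1
    simpa using h1
  rw [map_sub, map_smul, smul_eq_mul, zpow_neg_one]
  field_simp
  linear_combination h2

/-- The linear form induced by `f` on `⋀² V / W`. -/
noncomputable def quotForm (f : V [⋀^Fin 2]→ₗ[ℂ] ℂ) (W : Submodule ℂ (⋀[ℂ]^2 V))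
    (hWH : W ≤ kernelHyperplane f) : (⋀[ℂ]^2 V ⧸ W) →ₗ[ℂ] ℂ :=
  W.liftQ (toLinearForm f) hWH

lemma toLinearForm_wedge (f : V [⋀^Fin 2]→ₗ[ℂ] ℂ) (u v : V) :
    toLinearForm f (wedge V u v) = f ![u, v] := by
  rw [toLinearForm, wedge_apply, exteriorPower.alternatingMapLinearEquiv_apply_ιMulti]

lemma map_swap (f : V [⋀^Fin 2]→ₗ[ℂ] ℂ) (u v : V) : f ![u, v] = -f ![v, u] := by
  have := f.map_swap ![v, u] (i := 0) (j := 1) (by decide)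
  rw [← this]
  congr 1
  funext i
  fin_cases i <;> rfl

lemma exact_quotForm (f : V [⋀^Fin 2]→ₗ[ℂ] ℂ) (W : Submodule ℂ (⋀[ℂ]^2 V))
    (hWH : W ≤ kernelHyperplane f) :
    Function.Exact (hyperplaneQuot W (kernelHyperplane f)).subtype (quotForm f W hWH) := by
  rw [LinearMap.exact_iff, Submodule.range_subtype]
  exact Submodule.ker_liftQ _ _ _

variable [FiniteDimensional ℂ V]

/-- A section `s` of `V ⊗ 𝒪` is killed by `wedgeForm W` when `v ∧ s v ∈ W`, hence `v ∧ s v = 0` by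
the Tango condition, so `s v = a v • v`; and `a = l (s v) / l v` is regular where `l ≠ 0`. -/
lemma tautInc_wedgeForm_exact (W : Submodule ℂ (⋀[ℂ]^2 V))
    (hW : ∀ u v : V, wedge V u v ∈ W → wedge V u v = 0) :
    (ShortComplex.mk _ _ (tautInc_wedgeForm W)).Exact := by
  refine exact_of_locally_exact _ fun x => ⟨⊤, trivial, fun U _ => ?_⟩
  intro (s : regSections V V 0 U)
  constructor
  · intro hs
    have h0 (x : U) (v : Punctured x.1) : wedge V v.1 (s.1 x v) = 0 := by
      have h1 : W.mkQ (wedge V v.1 (s.1 x v)) = 0 :=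
        congrFun (congrFun (congrArg Subtype.val hs) x) v
      exact hW _ _ ((Submodule.Quotient.mk_eq_zero W).1 h1)
    have h1 (x : U) : ∃ a : Punctured x.1 → ℂ, ∀ v, s.1 x v = a v • v.1 := by
      obtain ⟨l, hl⟩ := exists_mem_basicOpen x.1
      exact ⟨_, fun v => eq_smul_of_wedge_eq_zero (h0 x v) (ne_zero_of_mem_basicOpen hl v)⟩
    choose a ha using h1
    have h2 : (isRegular V ℂ (-1)).pred a := by
      apply (isRegular V ℂ (-1)).locality
      intro x
      obtain ⟨l, hl⟩ := exists_mem_basicOpen x.1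
      refine ⟨U ⊓ basicOpen l, ⟨x.2, hl⟩, homOfLE inf_le_left, ?_⟩
      have := isRegular_smul (V := V) (k := 0) (j := -1) (n := -1) (by norm_num)
        (isRegular_zpow l (-1) (inf_le_right : U ⊓ basicOpen l ≤ _))
        (isRegular_comp l ((isRegular V V 0).res (homOfLE inf_le_left : U ⊓ basicOpen l ⟶ U) _ s.2))
      convert this using 3 with y v
      have hv := ne_zero_of_mem_basicOpen y.2.2 v
      change a ⟨y.1, y.2.1⟩ v = l v.1 ^ (-1 : ℤ) * l (s.1 ⟨y.1, y.2.1⟩ v)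
      rw [ha ⟨y.1, y.2.1⟩ v, map_smul, smul_eq_mul, mul_left_comm, zpow_neg_one,
        inv_mul_cancel₀ hv, mul_one]
    exact ⟨(⟨a, h2⟩ : regSections V ℂ (-1) U),
      Subtype.ext (funext fun x => funext fun v => (ha x v).symm)⟩
  · rintro ⟨t, rfl⟩
    have := congrArg (fun φ => φ.val.app (.op U) t) (tautInc_wedgeForm W)
    exact this

lemma wedgeQuot_mono (W : Submodule ℂ (⋀[ℂ]^2 V))
    (hW : ∀ u v : V, wedge V u v ∈ W → wedge V u v = 0) : Mono (wedgeQuot W) :=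
  (tautInc_wedgeForm_exact W hW).mono_cokernelDesc

lemma tangoMap_mono (W : Submodule ℂ (⋀[ℂ]^2 V))
    (hW : ∀ u v : V, wedge V u v ∈ W → wedge V u v = 0) : Mono (tangoMap W) := by
  have := wedgeQuot_mono W hW
  have := twist_mono (-1) (wedgeQuot W)
  exact mono_comp _ _

variable (V) in
/-- The projection `V ⊗ 𝒪 ⟶ Q`. -/
noncomputable def quotProj : sec.{u, u} V V 0 ⟶ quotBundle V := cokernel.π (tautInc V)

instance : Epi (quotProj V) := inferInstanceAs (Epi (cokernel.π (tautInc V)))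

lemma quotProj_wedgeQuot (W : Submodule ℂ (⋀[ℂ]^2 V)) :
    quotProj V ≫ wedgeQuot W = wedgeForm W := cokernel.π_desc _ _ _

lemma quotProj_evalQuot (f : V [⋀^Fin 2]→ₗ[ℂ] ℂ) :
    quotProj V ≫ evalQuot f = evalForm f := cokernel.π_desc _ _ _

lemma nullCorrelationInc_evalQuot (f : V [⋀^Fin 2]→ₗ[ℂ] ℂ) :
    nullCorrelationInc f ≫ evalQuot f = 0 := kernel.condition _

lemma quotProj_wedgeQuot_mapSec (f : V [⋀^Fin 2]→ₗ[ℂ] ℂ) (W : Submodule ℂ (⋀[ℂ]^2 V))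
    (hWH : W ≤ kernelHyperplane f) :
    quotProj V ≫ wedgeQuot W ≫ mapSec.{u, u, 0} (quotForm f W hWH) 1 =
      - evalForm f := by
  rw [← Category.assoc, quotProj_wedgeQuot]
  apply SheafOfModules.hom_ext
  apply PresheafOfModules.hom_ext
  intro U
  apply ModuleCat.hom_ext
  apply LinearMap.ext
  intro (s : regSections V V 0 U.unop)
  refine Subtype.ext (funext fun x => funext fun v => ?_)
  change toLinearForm f (wedge V v.1 (s.1 x v)) = - toLinearForm f (wedge V (s.1 x v) v.1)
  rw [toLinearForm_wedge, toLinearForm_wedge, map_swap]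

/-- The sign is that of `f (v, s v) = -f (s v, v)`. -/
lemma wedgeQuot_mapSec (f : V [⋀^Fin 2]→ₗ[ℂ] ℂ) (W : Submodule ℂ (⋀[ℂ]^2 V))
    (hWH : W ≤ kernelHyperplane f) :
    wedgeQuot W ≫ mapSec.{u, u, 0} (quotForm f W hWH) 1 = evalQuot f ≫ (-𝟙 _) := by
  rw [← cancel_epi (quotProj V), quotProj_wedgeQuot_mapSec, Preadditive.comp_neg,
    Preadditive.comp_neg, Category.comp_id, quotProj_evalQuot]

lemma exact_nullCorrelationInc (f : V [⋀^Fin 2]→ₗ[ℂ] ℂ) (W : Submodule ℂ (⋀[ℂ]^2 V))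
    (hWH : W ≤ kernelHyperplane f) :
    ∃ w : nullCorrelationInc f ≫ wedgeQuot W ≫ mapSec.{u, u, 0} (quotForm f W hWH) 1 = 0,
      (ShortComplex.mk _ _ w).Exact := by
  have hm : Mono (-𝟙 (sec.{u, 0} V ℂ 1)) := inferInstance
  refine ⟨?_, ?_⟩
  · rw [wedgeQuot_mapSec, ← Category.assoc, nullCorrelationInc_evalQuot, zero_comp]
  · exact ShortComplex.exact_of_f_is_kernel _
      (isKernelCompMono (kernelIsKernel (evalQuot f)) (-𝟙 _) (wedgeQuot_mapSec f W hWH))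

/-- For each `w`, the form `f (w, ·)` is a section of `𝒪(1)` in the image of `evalForm f`, and it
generates `𝒪(1)` where it does not vanish. -/
lemma evalForm_locally_surjective (f : V [⋀^Fin 2]→ₗ[ℂ] ℂ) (hf : Nondegenerate f)
    (x : PSpace V) : ∃ U : Opens (PSpace V), x ∈ U ∧ ∀ U' ≤ U,
      Function.Surjective ((evalForm f).val.app (.op U')) := by
  obtain ⟨v⟩ : Nonempty (Punctured x) := inferInstance
  obtain ⟨w, hw⟩ : ∃ w, f ![v.1, w] ≠ 0 := by
    by_contra! h
    exact v.2.2 (hf _ h)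
  let l : Module.Dual ℂ V := toLinearForm f ∘ₗ wedge V w
  have hl (v : V) : l v = f ![w, v] := toLinearForm_wedge f w v
  refine ⟨basicOpen l, mem_basicOpen_of_ne_zero v ?_, fun U hU => ?_⟩
  · rw [hl, map_swap]
    exact neg_ne_zero.2 hw
  · intro (t : regSections V ℂ 1 U)
    have h1 := isRegular_smul (V := V) (k := 1) (j := -1) (n := 0) (by norm_num)
      (isRegular_zpow l (-1) hU) t.2
    refine ⟨(⟨fun y v => (l v.1 ^ (-1 : ℤ) * t.1 y v) • w,
      isRegular_comp (LinearMap.toSpanSingleton ℂ V w) h1⟩ : regSections V V 0 U), ?_⟩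
    refine Subtype.ext (funext fun y => funext fun v => ?_)
    have hv := ne_zero_of_mem_basicOpen (hU y.2) v
    change toLinearForm f (wedge V ((l v.1 ^ (-1 : ℤ) * t.1 y v) • w) v.1) = t.1 y v
    rw [map_smul, LinearMap.smul_apply, map_smul]
    change (l v.1 ^ (-1 : ℤ) * t.1 y v) * l v.1 = t.1 y v
    rw [zpow_neg_one]
    field_simp

/-- The composite of `ϖ_W` with the linear form `f` on `⋀² V / W` is, up to sign, the twist of
`Q ⟶ 𝒪(1)` followed by the isomorphism `𝒪(1)(-1) ≅ 𝒪`. -/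
lemma tangoMap_mapSec (f : V [⋀^Fin 2]→ₗ[ℂ] ℂ) (W : Submodule ℂ (⋀[ℂ]^2 V))
    (hWH : W ≤ kernelHyperplane f) :
    tangoMap W ≫ mapSec.{u, u, 0} (quotForm f W hWH) 0 =
      (twist (-1)).map (wedgeQuot W ≫ mapSec.{u, u, 0} (quotForm f W hWH) 1) ≫
        mulSec.{u, 0} ℂ 1 (-1) 0 (by norm_num) := by
  rw [tangoMap, Category.assoc, ← twist_map_mapSec_mulSec.{u, u, 0}, Functor.map_comp,
    Category.assoc]

lemma epi_tangoMap_mapSec (f : V [⋀^Fin 2]→ₗ[ℂ] ℂ) (hf : Nondegenerate f)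
    (W : Submodule ℂ (⋀[ℂ]^2 V)) (hWH : W ≤ kernelHyperplane f) :
    Epi (tangoMap W ≫ mapSec.{u, u, 0} (quotForm f W hWH) 0) := by
  rw [tangoMap_mapSec]
  have h1 : Epi ((twist (-1)).map (-evalForm f)) := by
    refine twist_epi _ _ fun x => ?_
    obtain ⟨U, hx, hU⟩ := evalForm_locally_surjective f hf x
    refine ⟨U, hx, fun U' hU' t => ?_⟩
    obtain ⟨s, hs⟩ := hU U' hU' (-t)
    exact ⟨s, (congrArg Neg.neg hs).trans (neg_neg t)⟩
  rw [← quotProj_wedgeQuot_mapSec f W hWH, Functor.map_comp] at h1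
  have h2 := epi_of_epi ((twist (-1)).map (quotProj V))
    ((twist (-1)).map (wedgeQuot W ≫ mapSec.{u, u, 0} (quotForm f W hWH) 1))
  exact epi_comp _ _

lemma exact_twist_nullCorrelationInc (f : V [⋀^Fin 2]→ₗ[ℂ] ℂ) (W : Submodule ℂ (⋀[ℂ]^2 V))
    (hWH : W ≤ kernelHyperplane f) :
    ∃ w : (twist (-1)).map (nullCorrelationInc f) ≫
        tangoMap W ≫ mapSec.{u, u, 0} (quotForm f W hWH) 0 = 0,
      (ShortComplex.mk _ _ w).Exact := by
  obtain ⟨w₀, h₀⟩ := exact_nullCorrelationInc f W hWH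
  have : Mono (nullCorrelationInc f) := inferInstanceAs (Mono (kernel.ι (evalQuot f)))
  have : Mono ((twist (-1)).map (nullCorrelationInc f)) := twist_mono (-1) _
  have : Mono (ShortComplex.map (ShortComplex.mk _ _ w₀) (twist (-1))).f := this
  have w₁ : (twist (-1)).map (nullCorrelationInc f) ≫
      (twist (-1)).map (wedgeQuot W ≫ mapSec.{u, u, 0} (quotForm f W hWH) 1) = 0 := by
    rw [← Functor.map_comp, w₀, Functor.map_zero]
  have h₁ : IsLimit (KernelFork.ofι _ w₁) := (twist_exact_of_mono (-1) _ h₀).fIsKernel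
  refine ⟨?_, ?_⟩
  · rw [tangoMap_mapSec, reassoc_of% w₁, zero_comp]
  · exact ShortComplex.exact_of_f_is_kernel _
      (isKernelCompMono h₁ (mulSec.{u, 0} ℂ 1 (-1) 0 (by norm_num)) (tangoMap_mapSec f W hWH))

end Bundles

end ProjBundle

theorem proposition3p2p1 {V : Type u} [AddCommGroup V] [Module ℂ V] [FiniteDimensional ℂ V]
    (n : ℕ) (hV : Module.finrank ℂ V = 2 * n + 2)
    (f : V [⋀^Fin 2]→ₗ[ℂ] ℂ) (hf : ProjBundle.Nondegenerate f)
    (W : Submodule ℂ (⋀[ℂ]^2 V)) (hW : ProjBundle.TangoCondition n W)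
    (hWH : W ≤ ProjBundle.kernelHyperplane f)
    (F : ProjBundle.Mod V)
    (p : ProjBundle.sec.{u, u} V (⋀[ℂ]^2 V ⧸ W) 0 ⟶ (ProjBundle.twist 1).obj F)
    (hF : ProjBundle.IsTangoBundle W F p) :
    ∃ (i : (ProjBundle.twist (-1)).obj (ProjBundle.nullCorrelation f) ⟶
          ProjBundle.sec.{u, u} V
            (ProjBundle.hyperplaneQuot W (ProjBundle.kernelHyperplane f)) 0)
      (w : i ≫ ProjBundle.hyperplaneInc W (ProjBundle.kernelHyperplane f) ≫ p = 0),
      i ≫ ProjBundle.hyperplaneInc W (ProjBundle.kernelHyperplane f) =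
        (ProjBundle.twist (-1)).map (ProjBundle.nullCorrelationInc f) ≫ ProjBundle.tangoMap W ∧
      (ShortComplex.mk i (ProjBundle.hyperplaneInc W (ProjBundle.kernelHyperplane f) ≫ p)
        w).ShortExact := by
  have : Mono (ProjBundle.nullCorrelationInc f) :=
    inferInstanceAs (Mono (kernel.ι (ProjBundle.evalQuot f)))
  have : Mono ((ProjBundle.twist (-1)).map (ProjBundle.nullCorrelationInc f)) :=
    ProjBundle.twist_mono (-1) _
  have : Mono (ProjBundle.tangoMap W) := ProjBundle.tangoMap_mono W hW.2
  have : Mono (ProjBundle.hyperplaneInc W (ProjBundle.kernelHyperplane f)) :=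
    ProjBundle.mapSec_mono.{u, u} _ (Submodule.injective_subtype _) 0
  have : Epi p := hF.epi
  have := ProjBundle.epi_tangoMap_mapSec f hf W hWH
  obtain ⟨w₁, h₁⟩ := ProjBundle.exact_twist_nullCorrelationInc f W hWH
  exact ProjBundle.exists_shortExact_of_factor _ (ProjBundle.tangoMap W)
    (ProjBundle.mapSec.{u, u, 0} (ProjBundle.quotForm f W hWH) 0)
    (ProjBundle.hyperplaneInc W (ProjBundle.kernelHyperplane f)) p w₁ h₁ _
    (ProjBundle.mapSec_exact.{u, 0} _ _ (Submodule.injective_subtype _)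
      (ProjBundle.exact_quotForm f W hWH) 0) _ hF.exact
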